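/- Let $N\ge 2$ and let $G$ be a connected undirected graph (without loops) on the agents $\mathcal N=\{1,\dots,N\}$, with neighbour sets $\mathcal N_i$, degrees $d_i=|\mathcal N_i|$ and Laplacian matrix $L$. Let $\|\cdot\|_\infty$ be the maximum norm on $\mathbb R^N$ and also the induced matrix norm, $\mathbf 1=(1,\dots,1)^\top$, and $\mathrm{ave}(v)=\frac1N\sum_i v_i$. Fix $0<\gamma\le\lambda_2(L)$, where $\lambda_2(L)$ is the second smallest eigenvalue of $L$, and put $$\Gamma_\infty=\sup_{t\ge0}\big\|e^{\gamma t}\big(e^{-Lt}-\tfrac1N\mathbf 1\mathbf 1^\top\big)\big\|_\infty,\qquad |||v|||_\infty=\sup_{t\ge0}\big\|e^{\gamma t}e^{-Lt}(v-\mathrm{ave}(v)\mathbf 1)\big\|_\infty .$$ Let $R=2R_0+1$ with $R_0\in\mathbb N_0$, let $E_0>0$, $\omega>0$, let $\delta_i,\tau^i_{\max},\tau^i_{\min}>0$ for $i\in\mathcal N$, and let $x_0\in\mathbb R^N$ satisfy $|x_{i0}-\mathrm{ave}(x_0)|\le E_0$ for all $i$. Put $E(t)=2\Gamma_\infty E_0e^{-\omega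 t}$. For $E>0$ let $Q_{E,R}$ be the odd function on $[-E,E]$ with $Q_{E,R}[z]=0$ for $|z|\le E/R$ and $Q_{E,R}[z]=2pE/R$ for $(2p-1)E/R<z\le(2p+1)E/R$, $1\le p\le R_0$. Consider a run on $[0,\infty)$ of the quantized self-triggered system with initial state $x_0$: a state $x$, a locally integrable input $u$ and sampling times $t^i_k$ ($i\in\mathcal N$, $k\in\mathbb N_0$) such that $t^i_0=0$, $$x_i(t)=x_{i0}+\int_0^tu_i(s)\,ds\quad(t\ge0),\qquad t^i_{k+1}=t^i_k+\min\{\tau^i_k,\tau^i_{\max}\},$$ $$\tau^i_k=\inf\Big\{\tau\ge\tau^i_{\min}:\Big|\sum_{j\in\mathcal N_i}\int_{t^i_k}^{t^i_k+\tau}(u_i(s)-u_j(s))\,ds\Big|\ge\delta_iE(t^i_k+\tau)\Big\}\qquad(\inf\emptyset=\infty),$$ and such that, for all $i$ and $k$ for which the unsaturation condition $|x_i(t^i_k)-x_j(t^i_k)|\le E(t^i_k)$ for all $j\in\mathcal N_i$ holds, $$u_i(t)=-\sum_{j\in\mathcal N_i}Q_{E(t^i_k),R}\big[x_i(t^i_k)-x_j(t^i_k)\big]\qquad(t^i_k\le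 t<t^i_{k+1}).$$ (On sampling intervals on which the unsaturation condition fails, nothing else is required of $u_i$.) Let $\kappa(\omega)=\max_{i\in\mathcal N}\big(\delta_i+d_ie^{\omega\tau^i_{\max}}/R\big)$, and let $$\tilde\tau^i_{\min}=\min\Big\{\tau>0:\tau\Big(d_i^2+\sum_{j\in\mathcal N_i}d_je^{\omega\tau^j_{\max}}\Big)=\delta_ie^{-\omega\tau}\Big\}.$$ Assume that $0<\tau^i_{\min}\le\min\{\tilde\tau^i_{\min},\tau^i_{\max}\}$ for every $i$ and that $0<\omega\le\gamma-2\Gamma_\infty\kappa(\omega)$. Then $$|||x(t)|||_\infty\le\frac{E(t)}2\qquad\text{for all }t\ge0.$$ -/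

import Mathlib

namespace QuantizedConsensus

noncomputable section

/-! ### Linear algebra: averages, the maximum norm, and the Laplacian semigroup

The norm `‖v‖` of `v : Fin N → ℝ` is Mathlib's norm on a finite product, i.e. the maximum norm. -/

/-- The average of the entries of a vector. -/
def ave {N : ℕ} (v : Fin N → ℝ) : ℝ := (1 / (N : ℝ)) * ∑ i, v i

/-- The rank-one averaging matrix, all of whose entries are `1 / N`. -/
def averagingMatrix (N : ℕ) : Matrix (Fin N) (Fin N) ℝ :=
  Matrix.of fun _ _ => 1 / (N : ℝ)

/-- The matrix norm induced by the maximum norm: the largest absolute row sum. -/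
def maxRowSum {N : ℕ} (A : Matrix (Fin N) (Fin N) ℝ) : ℝ :=
  ⨆ i : Fin N, ∑ j : Fin N, |A i j|

/-- The second smallest eigenvalue (counted with multiplicity) of a symmetric matrix of size
at least two. Mathlib's `eigenvalues₀` lists the eigenvalues in decreasing order, so this is
the one at position `N - 2` (counting from `0`). -/
def lambda2 {N : ℕ} (hN : 2 ≤ N) {P : Matrix (Fin N) (Fin N) ℝ} (hP : P.IsHermitian) : ℝ :=
  hP.eigenvalues₀ ⟨N - 2, by rw [Fintype.card_fin]; omega⟩

/-- The second smallest eigenvalue `λ₂(L)` of the Laplacian of a graph. -/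
def algebraicConnectivity {N : ℕ} (hN : 2 ≤ N) (G : SimpleGraph (Fin N))
    [DecidableRel G.Adj] : ℝ :=
  lambda2 hN (G.isHermitian_lapMatrix ℝ)

/-- The matrix exponential `e^{-Lt}`, with `L` the Laplacian of the graph `G`. -/
def expNegLap {N : ℕ} (G : SimpleGraph (Fin N)) [DecidableRel G.Adj] (t : ℝ) :
    Matrix (Fin N) (Fin N) ℝ :=
  NormedSpace.exp (-(t • G.lapMatrix ℝ))

/-- `Γ_∞(γ) = sup_{t ≥ 0} ‖e^{γ t} (e^{-Lt} - (1/N) 1 1ᵀ)‖_∞`. -/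
def GammaInf {N : ℕ} (G : SimpleGraph (Fin N)) [DecidableRel G.Adj] (γ : ℝ) : ℝ :=
  ⨆ t : Set.Ici (0 : ℝ),
    maxRowSum (Real.exp (γ * (t : ℝ)) • (expNegLap G (t : ℝ) - averagingMatrix N))

/-- The semi-norm `|||v|||_∞ = sup_{t ≥ 0} ‖e^{γ t} e^{-Lt} (v - ave(v) 1)‖_∞`. -/
def consensusSeminorm {N : ℕ} (G : SimpleGraph (Fin N)) [DecidableRel G.Adj] (γ : ℝ)
    (v : Fin N → ℝ) : ℝ :=
  ⨆ t : Set.Ici (0 : ℝ),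
    ‖Real.exp (γ * (t : ℝ)) • (expNegLap G (t : ℝ)).mulVec (v - fun _ => ave v)‖

/-! ### The uniform quantizer -/

/-- The uniform quantizer `Q_{E,R}`. Only its values on `[-E, E]` matter below. The lemmas that
follow say that it has the three defining properties of the quantizer: value `2pE/R` on the cell
`((2p-1)E/R, (2p+1)E/R]` for `p ≥ 1`, value `0` on `[-E/R, E/R]`, and oddness. -/
def quantize (E : ℝ) (R : ℕ) (z : ℝ) : ℝ :=
  if |z| ≤ E / R then 0
  else if 0 < z then 2 * (⌈(z * R / E - 1) / 2⌉ : ℝ) * E / R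
  else -(2 * (⌈(-z * R / E - 1) / 2⌉ : ℝ) * E / R)

theorem quantize_of_abs_le {E : ℝ} {R : ℕ} {z : ℝ} (hz : |z| ≤ E / R) :
    quantize E R z = 0 := by
  simp [quantize, hz]

theorem quantize_of_mem_cell {E : ℝ} (hE : 0 < E) {R : ℕ} (hR : 0 < R) {z : ℝ} {p : ℕ}
    (hp : 1 ≤ p) (h1 : (2 * (p : ℝ) - 1) * E / R < z) (h2 : z ≤ (2 * (p : ℝ) + 1) * E / R) :
    quantize E R z = 2 * (p : ℝ) * E / R := by
  have hR' : (0 : ℝ) < R := by exact_mod_cast hR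
  have hp' : (1 : ℝ) ≤ p := by exact_mod_cast hp
  have h3 : E / R < z := by
    refine lt_of_le_of_lt ?_ h1
    gcongr
    nlinarith
  have hz : 0 < z := lt_trans (by positivity) h3
  have hc : ⌈(z * R / E - 1) / 2⌉ = (p : ℤ) := by
    rw [Int.ceil_eq_iff]
    rw [div_lt_iff₀ hR'] at h1
    rw [le_div_iff₀ hR'] at h2
    have h4 : 2 * (p : ℝ) - 1 < z * R / E := by rwa [lt_div_iff₀ hE]
    have h5 : z * R / E ≤ 2 * (p : ℝ) + 1 := by rwa [div_le_iff₀ hE]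
    push_cast
    constructor <;> linarith
  rw [quantize, if_neg (by rw [abs_of_pos hz]; exact not_le.mpr h3), if_pos hz, hc]
  push_cast
  ring

theorem quantize_neg {E : ℝ} (hE : 0 < E) (R : ℕ) (z : ℝ) :
    quantize E R (-z) = -quantize E R z := by
  unfold quantize
  rw [abs_neg]
  by_cases h : |z| ≤ E / R
  · simp [h]
  · rcases lt_trichotomy z 0 with hz | hz | hz
    · simp [h, hz, not_lt.mpr hz.le]
    · exact absurd (by rw [hz, abs_zero]; positivity) h
    · simp [h, hz, not_lt.mpr hz.le]

/-! ### The closed loop -/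

/-- The quantization range `E(t) = 2 Γ_∞ E₀ e^{-ω t}`. -/
def quantRange {N : ℕ} (G : SimpleGraph (Fin N)) [DecidableRel G.Adj] (γ E₀ ω t : ℝ) : ℝ :=
  2 * GammaInf G γ * E₀ * Real.exp (-ω * t)

/-- Agent `i` is unsaturated at time `s`: its relative states lie in `[-E(s), E(s)]`. -/
def Unsaturated {N : ℕ} (G : SimpleGraph (Fin N)) (E : ℝ → ℝ) (x : ℝ → Fin N → ℝ)
    (i : Fin N) (s : ℝ) : Prop :=
  ∀ j, G.Adj i j → |x s i - x s j| ≤ E s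

/-- The sum `q_i(s)` of the quantized relative states that agent `i` measures at time `s`. -/
def quantizedSum {N : ℕ} (G : SimpleGraph (Fin N)) [DecidableRel G.Adj] (E : ℝ → ℝ) (R : ℕ)
    (x : ℝ → Fin N → ℝ) (i : Fin N) (s : ℝ) : ℝ :=
  ∑ j ∈ G.neighborFinset i, quantize (E s) R (x s i - x s j)

/-- The sampling error of agent `i`, a time `τ` after a sampling at time `s`, as computed from
the inputs `u`: the sum over the neighbours `j` of `∫_s^{s+τ} (u_i - u_j)`. -/
def samplingError {N : ℕ} (G : SimpleGraph (Fin N)) [DecidableRel G.Adj]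
    (u : ℝ → Fin N → ℝ) (i : Fin N) (s τ : ℝ) : ℝ :=
  ∑ j ∈ G.neighborFinset i, ∫ r in s..(s + τ), (u r i - u r j)

/-- The first time `τ ≥ τ_min^i` after the sampling time `s` at which the sampling error of
agent `i` reaches the threshold `δ_i E(s + τ)`; it is `⊤` if there is no such time. -/
def triggerDelay {N : ℕ} (G : SimpleGraph (Fin N)) [DecidableRel G.Adj] (E : ℝ → ℝ)
    (δ τmin : Fin N → ℝ) (u : ℝ → Fin N → ℝ) (i : Fin N) (s : ℝ) : EReal :=
  sInf ((fun τ : ℝ => (τ : EReal)) ''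
    {τ : ℝ | τmin i ≤ τ ∧ δ i * E (s + τ) ≤ |samplingError G u i s τ|})

/-- `x` is a state, `u` the input and `T i k` (`k = 0, 1, …`) the sampling times of agent `i` in
a run on `[0, ∞)` of the quantized self-triggered multi-agent system with initial state `x₀`.
The input of agent `i` is `-q_i` evaluated at its latest sampling time, provided that agent `i`
was unsaturated at that time; nothing but local integrability is required of its input on the
other sampling intervals. -/
structure IsRun {N : ℕ} (G : SimpleGraph (Fin N)) [DecidableRel G.Adj] (E : ℝ → ℝ) (R : ℕ)
    (δ τmin τmax : Fin N → ℝ) (x₀ : Fin N → ℝ)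
    (x u : ℝ → Fin N → ℝ) (T : Fin N → ℕ → ℝ) : Prop where
  integrable : ∀ i t, 0 ≤ t →
    IntervalIntegrable (fun s => u s i) MeasureTheory.volume 0 t
  /-- The dynamics `x_i' = u_i`, `x_i(0) = x_{i0}`, in integrated form. -/
  dynamics : ∀ i t, 0 ≤ t → x t i = x₀ i + ∫ s in (0 : ℝ)..t, u s i
  start : ∀ i, T i 0 = 0
  /-- The triggering mechanism. -/
  step : ∀ i k, (T i (k + 1) : EReal) =
    (T i k : EReal) + min (triggerDelay G E δ τmin u i (T i k)) (τmax i : EReal)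
  input : ∀ i k, Unsaturated G E x i (T i k) → ∀ t, T i k ≤ t → t < T i (k + 1) →
    u t i = -quantizedSum G E R x i (T i k)

/-! ### Design parameters -/

/-- `κ(ω) = max_i (δ_i + d_i e^{ω τ_max^i} / R)`. -/
def kappa {N : ℕ} (G : SimpleGraph (Fin N)) [DecidableRel G.Adj] (R : ℕ)
    (δ τmax : Fin N → ℝ) (ω : ℝ) : ℝ :=
  ⨆ i : Fin N, (δ i + (G.degree i : ℝ) * Real.exp (ω * τmax i) / (R : ℝ))

/-- The smallest `τ > 0` with
`τ (d_i ^ 2 + ∑_{j ∈ N_i} d_j e^{ω τ_max^j}) = δ_i e^{-ω τ}`. -/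
def tauTilde {N : ℕ} (G : SimpleGraph (Fin N)) [DecidableRel G.Adj]
    (δ τmax : Fin N → ℝ) (ω : ℝ) (i : Fin N) : ℝ :=
  sInf {τ : ℝ | 0 < τ ∧
    τ * ((G.degree i : ℝ) ^ 2 +
        ∑ j ∈ G.neighborFinset i, (G.degree j : ℝ) * Real.exp (ω * τmax j)) =
      δ i * Real.exp (-ω * τ)}

end

end QuantizedConsensus

namespace QuantizedConsensus

/-! Put `w = u + L x`, so that `x' = -L x + w`, and let `P(t) = e^{-Lt} - (1/N) 1 1ᵀ`. Connectedness
makes the constants the only zero mode of `L`, and all other eigenvalues are at least `γ`. Hence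
`P(t)` decays like `e^{-γt}` with finite constant `Γ = Γ_∞` (`exp_mul_norm_mulVec_le`). If `‖w(s)‖ ≤
κ E(s)` for `s < t`, variation of constants bounds `|||x(t)|||` by `Γ E₀ e^{-γt}` plus the integral
of `Γ e^{-γ(t-s)} κ · 2 Γ E₀ e^{-ωs}`. Since `2Γκ ≤ γ - ω`, the total is at most `Γ E₀ e^{-ωt} =
E(t)/2` (`consensusSeminorm_le_of_hasDerivWithinAt`).

The perturbation `w_i` is the drift of the relative states since the last sampling plus the
quantization error at that sampling. The trigger and the choice of `τmin` keep the drift below `δ_i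
E(s)`. The quantization error is at most `d_i E/R` at the sampling time, and `E` shrinks by at most
`e^{ωτmax}` between samplings (`norm_input_add_lapMatrix_mulVec_le`).

This needs every sampling up to `s` to be unsaturated, which in turn follows from the desired bound
at the sampling times (`abs_sub_le_of_consensusSeminorm_le`). The circle is broken by induction on
the number of sampling times before `t`, finite because consecutive samplings of an agent are at
least `τmin` apart. -/

/-! ### The Laplacian semigroup -/

section Semigroup

open Matrix

variable {N : ℕ} (G : SimpleGraph (Fin N)) [DecidableRel G.Adj]

/-- The entries of `e^{-Lt}` in an orthonormal basis of eigenvectors of `L`. -/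
theorem expNegLap_apply (t : ℝ) (i j : Fin N) :
    expNegLap G t i j = ∑ k, ((G.isHermitian_lapMatrix ℝ).eigenvectorBasis k).ofLp i *
      Real.exp (-(t * (G.isHermitian_lapMatrix ℝ).eigenvalues k)) *
        ((G.isHermitian_lapMatrix ℝ).eigenvectorBasis k).ofLp j := by
  set hL := G.isHermitian_lapMatrix ℝ
  set U := (hL.eigenvectorUnitary : Matrix (Fin N) (Fin N) ℝ) with hU
  have hUU : U * star U = 1 := Unitary.mul_star_self_of_mem hL.eigenvectorUnitary.2
  have hinv : U⁻¹ = star U := Matrix.inv_eq_right_inv hUU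
  have hunit : IsUnit U := IsUnit.of_mul_eq_one _ hUU
  have hspec : G.lapMatrix ℝ = U * diagonal hL.eigenvalues * star U := by
    conv_lhs => rw [hL.spectral_theorem]
    rfl
  have hexp : expNegLap G t =
      U * diagonal (fun k => Real.exp (-(t * hL.eigenvalues k))) * star U := by
    have h1 : -(t • G.lapMatrix ℝ) =
        U * diagonal (fun k => -(t * hL.eigenvalues k)) * U⁻¹ := by
      conv_lhs => rw [hspec]
      rw [hinv, ← Matrix.smul_mul, ← Matrix.mul_smul, ← Matrix.neg_mul, ← Matrix.mul_neg]
      congr 2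
      ext a b
      by_cases h : a = b <;> simp [h, diagonal]
    rw [expNegLap, h1, Matrix.exp_conj _ _ hunit, Matrix.exp_diagonal, hinv]
    congr 3
    ext k
    rw [Pi.coe_exp, Real.exp_eq_exp_ℝ]
  rw [hexp, Matrix.mul_apply]
  refine Finset.sum_congr rfl fun k _ => ?_
  rw [Matrix.mul_diagonal, hU, Matrix.star_apply, star_trivial,
    IsHermitian.eigenvectorUnitary_apply, IsHermitian.eigenvectorUnitary_apply]

/-- All eigenvalues of the Laplacian but one, which is `0`, are at least `γ`. -/
theorem exists_eigenvalue_eq_zero (hN : 2 ≤ N) {γ : ℝ} (hγ : 0 < γ)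
    (hγ_le : γ ≤ algebraicConnectivity hN G) :
    ∃ k₀, (G.isHermitian_lapMatrix ℝ).eigenvalues k₀ = 0 ∧
      ∀ k, k ≠ k₀ → γ ≤ (G.isHermitian_lapMatrix ℝ).eigenvalues k := by
  set hL := G.isHermitian_lapMatrix ℝ
  have : Nonempty (Fin N) := ⟨⟨0, by omega⟩⟩
  have hdet := hL.det_eq_prod_eigenvalues
  rw [SimpleGraph.det_lapMatrix_eq_zero] at hdet
  obtain ⟨k₀, -, hk₀⟩ := Finset.prod_eq_zero_iff.mp hdet.symm
  have hk₀' : hL.eigenvalues k₀ = 0 := hk₀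
  refine ⟨k₀, hk₀', fun k hk => ?_⟩
  set e := (Fintype.equivOfCardEq (Fintype.card_fin (Fintype.card (Fin N)))).symm with he
  have hval : ∀ k, hL.eigenvalues k = hL.eigenvalues₀ (e k) := fun k => rfl
  have hlast : ∀ k, ((e k : Fin _) : ℕ) ≤ N - 2 → γ ≤ hL.eigenvalues k := by
    intro k hk
    rw [hval]
    exact hγ_le.trans (hL.eigenvalues₀_antitone (Fin.le_def.mpr hk))
  -- Positions up to `N - 2` in the decreasing list carry values at least `γ > 0`, so the zero
  -- eigenvalue occupies the last position `N - 1`, and only `k₀` does.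
  by_cases h : ((e k : Fin _) : ℕ) ≤ N - 2
  · exact hlast k h
  · exfalso
    have h0 : ¬ ((e k₀ : Fin _) : ℕ) ≤ N - 2 := fun h0 => by
      have := hlast k₀ h0
      linarith
    have h1 := (e k).2
    have h2 := (e k₀).2
    have h3 : Fintype.card (Fin N) = N := Fintype.card_fin N
    apply hk
    apply e.injective
    apply Fin.ext
    omega

/-- In the spectral expansion the zero mode is a constant unit vector, whose rank-one term is
exactly the averaging matrix. Every remaining mode decays at rate at least `γ`. -/
theorem abs_exp_mul_expNegLap_sub_le (hN : 2 ≤ N) (hG : G.Connected) {γ : ℝ} (hγ : 0 < γ)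
    (hγ_le : γ ≤ algebraicConnectivity hN G) :
    ∃ C : Fin N → Fin N → ℝ, ∀ t, 0 ≤ t → ∀ i j,
      |(Real.exp (γ * t) • (expNegLap G t - averagingMatrix N)) i j| ≤ C i j := by
  obtain ⟨k₀, hk₀, hk⟩ := exists_eigenvalue_eq_zero G hN hγ hγ_le
  have happ := expNegLap_apply G
  set hL := G.isHermitian_lapMatrix ℝ
  set v : Fin N → Fin N → ℝ := fun k => (hL.eigenvectorBasis k).ofLp with hv
  have hNpos : (0 : ℝ) < N := by exact_mod_cast (by omega : 0 < N)
  have hconst : ∀ i j, v k₀ i = v k₀ j := fun i j => by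
    refine (G.lapMatrix_mulVec_eq_zero_iff_forall_reachable.mp ?_) i j (hG.preconnected i j)
    rw [hv, hL.mulVec_eigenvectorBasis, hk₀, zero_smul]
  have hnorm : ∑ i, v k₀ i ^ 2 = 1 := by
    have h1 : ‖hL.eigenvectorBasis k₀‖ = 1 := hL.eigenvectorBasis.orthonormal.1 k₀
    have h2 := EuclideanSpace.real_norm_sq_eq (hL.eigenvectorBasis k₀)
    rw [h1] at h2
    rw [← h2]; norm_num
  have hprod : ∀ i j, v k₀ i * v k₀ j = 1 / N := fun i j => by
    have h1 : ∑ l, v k₀ l ^ 2 = N * v k₀ i ^ 2 := by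
      rw [Finset.sum_congr rfl fun l _ => by rw [hconst l i]]
      simp
    rw [hconst j i, eq_div_iff hNpos.ne']
    rw [h1] at hnorm
    linarith
  refine ⟨fun i j => ∑ k, |v k i| * |v k j|, fun t ht i j => ?_⟩
  have hsum : expNegLap G t i j - averagingMatrix N i j =
      ∑ k ∈ Finset.univ.erase k₀, v k i * Real.exp (-(t * hL.eigenvalues k)) * v k j := by
    rw [happ, ← Finset.add_sum_erase _ _ (Finset.mem_univ k₀), hk₀]
    have := hprod i j
    simp only [averagingMatrix, Matrix.of_apply, ← this, mul_zero, neg_zero, Real.exp_zero, hv]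
    ring
  rw [Matrix.smul_apply, Matrix.sub_apply, hsum, smul_eq_mul, Finset.mul_sum]
  refine (Finset.abs_sum_le_sum_abs _ _).trans ?_
  refine (Finset.sum_le_sum fun k hk' => ?_).trans
    (Finset.sum_le_sum_of_subset_of_nonneg (Finset.erase_subset k₀ Finset.univ)
      fun k _ _ => by positivity)
  have h1 : Real.exp (γ * t) * (v k i * Real.exp (-(t * hL.eigenvalues k)) * v k j) =
      Real.exp (γ * t - t * hL.eigenvalues k) * (v k i * v k j) := by
    rw [sub_eq_add_neg, Real.exp_add]; ring
  rw [h1, abs_mul, abs_mul, Real.abs_exp]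
  refine mul_le_of_le_one_left (by positivity) (Real.exp_le_one_iff.mpr ?_)
  have := mul_le_mul_of_nonneg_left (hk k (Finset.ne_of_mem_erase hk')) ht
  linarith

theorem sum_abs_le_maxRowSum (A : Matrix (Fin N) (Fin N) ℝ) (i : Fin N) :
    ∑ j, |A i j| ≤ maxRowSum A :=
  le_ciSup (f := fun i => ∑ j, |A i j|) (Set.finite_range _).bddAbove i

theorem norm_mulVec_le_maxRowSum (A : Matrix (Fin N) (Fin N) ℝ) (v : Fin N → ℝ) :
    ‖A *ᵥ v‖ ≤ maxRowSum A * ‖v‖ := by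
  have h0 : 0 ≤ maxRowSum A := Real.iSup_nonneg fun i => Finset.sum_nonneg fun j _ => abs_nonneg _
  refine (pi_norm_le_iff_of_nonneg (by positivity)).mpr fun i => ?_
  rw [Real.norm_eq_abs, mulVec, dotProduct]
  calc |∑ j, A i j * v j| ≤ ∑ j, |A i j * v j| := Finset.abs_sum_le_sum_abs _ _
    _ ≤ ∑ j, |A i j| * ‖v‖ := Finset.sum_le_sum fun j _ => by
        rw [abs_mul]
        exact mul_le_mul_of_nonneg_left (norm_le_pi_norm v j) (abs_nonneg _)
    _ = (∑ j, |A i j|) * ‖v‖ := (Finset.sum_mul _ _ _).symm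
    _ ≤ maxRowSum A * ‖v‖ :=
        mul_le_mul_of_nonneg_right (sum_abs_le_maxRowSum A i) (norm_nonneg v)

/-- A real supremum over an unbounded family is `0` by default; boundedness is what lets `GammaInf`
dominate each of its terms. -/
theorem bddAbove_maxRowSum_exp (hN : 2 ≤ N) (hG : G.Connected) {γ : ℝ} (hγ : 0 < γ)
    (hγ_le : γ ≤ algebraicConnectivity hN G) :
    BddAbove (Set.range fun t : Set.Ici (0 : ℝ) =>
      maxRowSum (Real.exp (γ * (t : ℝ)) • (expNegLap G (t : ℝ) - averagingMatrix N))) := by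
  obtain ⟨C, hC⟩ := abs_exp_mul_expNegLap_sub_le G hN hG hγ hγ_le
  have : Nonempty (Fin N) := ⟨⟨0, by omega⟩⟩
  refine ⟨∑ i, ∑ j, C i j, ?_⟩
  rintro _ ⟨⟨t, ht⟩, rfl⟩
  have h0 : ∀ i j, 0 ≤ C i j := fun i j => (abs_nonneg _).trans (hC t ht i j)
  refine ciSup_le fun i => ?_
  refine (Finset.sum_le_sum fun j _ => hC t ht i j).trans ?_
  exact Finset.single_le_sum (f := fun i => ∑ j, C i j)
    (fun i _ => Finset.sum_nonneg fun j _ => h0 i j) (Finset.mem_univ i)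

/-- `‖e^{γt} (e^{-Lt} - (1/N) 1 1ᵀ) v‖ ≤ Γ_∞ ‖v‖`. -/
theorem exp_mul_norm_mulVec_le (hN : 2 ≤ N) (hG : G.Connected) {γ : ℝ} (hγ : 0 < γ)
    (hγ_le : γ ≤ algebraicConnectivity hN G) {t : ℝ} (ht : 0 ≤ t) (v : Fin N → ℝ) :
    Real.exp (γ * t) * ‖(expNegLap G t - averagingMatrix N) *ᵥ v‖ ≤ GammaInf G γ * ‖v‖ := by
  have h1 := norm_mulVec_le_maxRowSum
    (Real.exp (γ * t) • (expNegLap G t - averagingMatrix N)) v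
  rw [Matrix.smul_mulVec, norm_smul, Real.norm_eq_abs, Real.abs_exp] at h1
  refine h1.trans (mul_le_mul_of_nonneg_right ?_ (norm_nonneg v))
  exact le_ciSup (bddAbove_maxRowSum_exp G hN hG hγ hγ_le) (⟨t, ht⟩ : Set.Ici (0 : ℝ))

theorem expNegLap_zero : expNegLap G 0 = 1 := by
  simp [expNegLap, NormedSpace.exp_zero]

/-- At `t = 0` the matrix is `I - (1/N) 1 1ᵀ`, with off-diagonal entries `-1/N`. Positivity makes
the quantization range positive. -/
theorem GammaInf_pos (hN : 2 ≤ N) (hG : G.Connected) {γ : ℝ} (hγ : 0 < γ)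
    (hγ_le : γ ≤ algebraicConnectivity hN G) : 0 < GammaInf G γ := by
  let a : Fin N := ⟨0, by omega⟩
  let b : Fin N := ⟨1, by omega⟩
  have hab : a ≠ b := by simp [a, b, Fin.ext_iff]
  have hNpos : (0 : ℝ) < N := by exact_mod_cast (by omega : 0 < N)
  refine lt_of_lt_of_le ?_ (le_ciSup (bddAbove_maxRowSum_exp G hN hG hγ hγ_le)
    (⟨0, Set.self_mem_Ici⟩ : Set.Ici (0 : ℝ)))
  refine lt_of_lt_of_le ?_ (sum_abs_le_maxRowSum _ a)
  refine lt_of_lt_of_le ?_ (Finset.single_le_sum (fun j _ => abs_nonneg _) (Finset.mem_univ b))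
  simp [expNegLap_zero, averagingMatrix, Matrix.one_apply_ne hab, hNpos]

open scoped Matrix.Norms.Operator in
theorem hasDerivAt_expNegLap_apply (t : ℝ) (i j : Fin N) :
    HasDerivAt (fun s => expNegLap G s i j) (-(expNegLap G t * G.lapMatrix ℝ) i j) t := by
  have h1 : HasDerivAt (fun s : ℝ => expNegLap G s) (expNegLap G t * (-G.lapMatrix ℝ)) t := by
    have := hasDerivAt_exp_smul_const (𝕂 := ℝ) (-G.lapMatrix ℝ) t
    simp only [smul_neg] at this
    exact this
  rw [Matrix.mul_neg] at h1
  exact (Matrix.entryLinearMap ℝ ℝ i j).toContinuousLinearMap.hasFDerivAt.comp_hasDerivAt t h1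

theorem hasDerivAt_expNegLap_mulVec (t : ℝ) (v : Fin N → ℝ) :
    HasDerivAt (fun s => expNegLap G s *ᵥ v) (-(expNegLap G t *ᵥ (G.lapMatrix ℝ *ᵥ v))) t := by
  rw [Matrix.mulVec_mulVec, ← Matrix.neg_mulVec]
  exact hasDerivAt_pi.mpr fun i =>
    HasDerivAt.fun_sum (u := Finset.univ) fun j _ => (hasDerivAt_expNegLap_apply G t i j).mul_const (v j)

theorem averagingMatrix_mulVec (v : Fin N → ℝ) : averagingMatrix N *ᵥ v = fun _ => ave v := by
  ext i
  simp [averagingMatrix, mulVec, dotProduct, ave, Finset.mul_sum]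

theorem averagingMatrix_mulVec_const (hN : 2 ≤ N) (c : ℝ) :
    averagingMatrix N *ᵥ (fun _ => c) = fun _ => c := by
  have hNpos : (N : ℝ) ≠ 0 := by exact_mod_cast (by omega : N ≠ 0)
  rw [averagingMatrix_mulVec]
  ext i
  simp [ave, hNpos]

theorem averagingMatrix_mulVec_lapMatrix_mulVec (v : Fin N → ℝ) :
    averagingMatrix N *ᵥ (G.lapMatrix ℝ *ᵥ v) = 0 := by
  ext i
  have h : (fun _ : Fin N => 1 / (N : ℝ)) ᵥ* G.lapMatrix ℝ = 0 := by
    rw [← Matrix.mulVec_transpose, (SimpleGraph.isSymm_lapMatrix ℝ G).eq]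
    ext i
    simp [SimpleGraph.lapMatrix_mulVec_apply]
  change (fun _ : Fin N => 1 / (N : ℝ)) ⬝ᵥ (G.lapMatrix ℝ *ᵥ v) = 0
  rw [Matrix.dotProduct_mulVec, h, zero_dotProduct]

/-- The differentiated variation-of-constants formula. -/
theorem hasDerivWithinAt_expNegLap_sub_mulVec {x : ℝ → Fin N → ℝ} {x' : Fin N → ℝ} {S : Set ℝ}
    {s : ℝ} (hx : HasDerivWithinAt x x' S s) (c : ℝ) :
    HasDerivWithinAt (fun r => (expNegLap G (c - r) - averagingMatrix N) *ᵥ x r)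
      ((expNegLap G (c - s) - averagingMatrix N) *ᵥ (x' + G.lapMatrix ℝ *ᵥ x s)) S s := by
  -- The product rule produces `e^{-L(c-s)} L x`; its factor may be replaced by `P(c-s) L x` because
  -- averaging annihilates the range of `L`.
  have hderiv : (expNegLap G (c - s) - averagingMatrix N) *ᵥ (x' + G.lapMatrix ℝ *ᵥ x s) =
      (expNegLap G (c - s) * G.lapMatrix ℝ) *ᵥ x s +
        (expNegLap G (c - s) - averagingMatrix N) *ᵥ x' := by
    rw [Matrix.mulVec_add, Matrix.sub_mulVec _ _ (_ *ᵥ _),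
      averagingMatrix_mulVec_lapMatrix_mulVec, Matrix.mulVec_mulVec]
    abel
  rw [hderiv]
  refine hasDerivWithinAt_pi.mpr fun i => ?_
  have h := HasDerivWithinAt.fun_sum (u := Finset.univ) fun j _ =>
    (((hasDerivAt_expNegLap_apply G (c - s) i j).comp_const_sub c s).sub_const
      (averagingMatrix N i j)).hasDerivWithinAt.mul (hasDerivWithinAt_pi.mp hx j)
  rw [Finset.sum_add_distrib] at h
  simp only [neg_neg] at h
  exact h

theorem expNegLap_mulVec_of_lapMatrix_mulVec_eq_zero {v : Fin N → ℝ}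
    (hv : G.lapMatrix ℝ *ᵥ v = 0) (t : ℝ) : expNegLap G t *ᵥ v = v := by
  have hd : ∀ s, HasDerivAt (fun s => expNegLap G s *ᵥ v) 0 s := fun s => by
    simpa [hv] using hasDerivAt_expNegLap_mulVec G s v
  have := is_const_of_deriv_eq_zero (fun s => (hd s).differentiableAt) (fun s => (hd s).deriv) t 0
  simpa [expNegLap_zero] using this

theorem expNegLap_mulVec_const (t c : ℝ) : expNegLap G t *ᵥ (fun _ => c) = fun _ => c := by
  refine expNegLap_mulVec_of_lapMatrix_mulVec_eq_zero G ?_ t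
  ext i
  simp [SimpleGraph.lapMatrix_mulVec_apply]

theorem expNegLap_mulVec_sub_ave (t : ℝ) (v : Fin N → ℝ) :
    expNegLap G t *ᵥ (v - fun _ => ave v) = (expNegLap G t - averagingMatrix N) *ᵥ v := by
  rw [Matrix.mulVec_sub, expNegLap_mulVec_const, Matrix.sub_mulVec, averagingMatrix_mulVec]

end Semigroup

/-! ### Quantization errors -/

section Quantizer

/-- With `z = (2y + 1)E/R` the quantizer rounds `y` up to `p`, so the error is at most half a cell,
`E/R`. Because `R = 2R₀ + 1`, `z ≤ E` gives `y ≤ R₀`, hence `p ≤ R₀` and the output stays below `E`.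
-/
theorem quantize_bounds_of_pos {E : ℝ} (hE : 0 < E) (R₀ : ℕ) {z : ℝ} (hz : 0 < z) (hzE : z ≤ E) :
    |z - quantize E (2 * R₀ + 1) z| ≤ E / (2 * R₀ + 1 : ℕ) ∧
      |quantize E (2 * R₀ + 1) z| ≤ E := by
  have hR : (0 : ℝ) < (2 * R₀ + 1 : ℕ) := by positivity
  by_cases h : |z| ≤ E / (2 * R₀ + 1 : ℕ)
  · rw [quantize_of_abs_le h]
    rw [sub_zero, abs_zero]
    exact ⟨h, hE.le⟩
  rw [quantize, if_neg h, if_pos hz]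
  rw [abs_of_pos hz, not_le] at h
  set R : ℝ := ((2 * R₀ + 1 : ℕ) : ℝ) with hRdef
  set y := (z * R / E - 1) / 2 with hy
  set p : ℝ := (⌈y⌉ : ℝ) with hp
  have hzy : z = (2 * y + 1) * E / R := by
    rw [hy]; field_simp; ring
  have h1 : y ≤ p := Int.le_ceil y
  have h2 : p < y + 1 := Int.ceil_lt_add_one y
  have h3 : p ≤ R₀ := by
    have : ⌈y⌉ ≤ (R₀ : ℤ) := by
      rw [Int.ceil_le]
      have : z * R / E ≤ R := by
        rw [div_le_iff₀ hE]; nlinarith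
      rw [hy]
      have hR2 : R = 2 * R₀ + 1 := by rw [hRdef]; push_cast; ring
      push_cast
      linarith
    rw [hp]
    exact_mod_cast this
  have hER : 0 < E / R := by positivity
  have hQ : 2 * p * E / R = 2 * p * (E / R) := by ring
  have hz' : z = (2 * y + 1) * (E / R) := by rw [hzy]; ring
  have hEE : E = (2 * R₀ + 1) * (E / R) := by
    rw [hRdef]; push_cast; field_simp
  have hy0 : 0 < y := by
    rw [hz'] at h
    nlinarith
  rw [hQ]
  constructor
  · rw [abs_le]
    constructor <;> nlinarith
  · rw [abs_of_nonneg (by positivity)]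
    nlinarith

theorem quantize_bounds {E : ℝ} (hE : 0 < E) (R₀ : ℕ) {z : ℝ} (hz : |z| ≤ E) :
    |z - quantize E (2 * R₀ + 1) z| ≤ E / (2 * R₀ + 1 : ℕ) ∧
      |quantize E (2 * R₀ + 1) z| ≤ E := by
  rcases lt_trichotomy z 0 with h | rfl | h
  · have := quantize_bounds_of_pos hE R₀ (neg_pos.mpr h) ((abs_of_neg h) ▸ hz)
    rw [quantize_neg hE, abs_neg, ← neg_sub', abs_neg] at this
    exact this
  · rw [quantize_of_abs_le (by rw [abs_zero]; positivity)]
    simp only [sub_zero, abs_zero]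
    exact ⟨by positivity, hE.le⟩
  · exact quantize_bounds_of_pos hE R₀ h ((abs_of_pos h) ▸ hz)

variable {N : ℕ} {G : SimpleGraph (Fin N)} [DecidableRel G.Adj] {E : ℝ → ℝ} {R₀ : ℕ}
  {x : ℝ → Fin N → ℝ} {i : Fin N} {s : ℝ}

theorem abs_quantizedSum_le (hE : 0 < E s) (h : Unsaturated G E x i s) :
    |quantizedSum G E (2 * R₀ + 1) x i s| ≤ G.degree i * E s := by
  refine (Finset.abs_sum_le_sum_abs _ _).trans ?_
  rw [← G.card_neighborFinset_eq_degree, ← nsmul_eq_mul]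
  exact Finset.sum_le_card_nsmul _ _ _ fun j hj =>
    (quantize_bounds hE R₀ (h j ((G.mem_neighborFinset i j).mp hj))).2

theorem abs_sum_sub_quantizedSum_le (hE : 0 < E s) (h : Unsaturated G E x i s) :
    |∑ j ∈ G.neighborFinset i, (x s i - x s j) - quantizedSum G E (2 * R₀ + 1) x i s| ≤
      G.degree i * (E s / (2 * R₀ + 1 : ℕ)) := by
  rw [quantizedSum, ← Finset.sum_sub_distrib]
  refine (Finset.abs_sum_le_sum_abs _ _).trans ?_
  rw [← G.card_neighborFinset_eq_degree, ← nsmul_eq_mul]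
  exact Finset.sum_le_card_nsmul _ _ _ fun j hj =>
    (quantize_bounds hE R₀ (h j ((G.mem_neighborFinset i j).mp hj))).1

theorem lapMatrix_mulVec_eq_sum_sub (v : Fin N → ℝ) (i : Fin N) :
    (G.lapMatrix ℝ).mulVec v i = ∑ j ∈ G.neighborFinset i, (v i - v j) := by
  rw [SimpleGraph.lapMatrix_mulVec_apply, Finset.sum_sub_distrib, Finset.sum_const,
    G.card_neighborFinset_eq_degree, nsmul_eq_mul]

end Quantizer

/-! ### Sampling times -/

/-- The left side is nondecreasing in `τ`, the right side is decreasing, and they agree at a root to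
the right of `τ`. -/
theorem mul_le_of_lt_tauTilde {N : ℕ} (G : SimpleGraph (Fin N)) [DecidableRel G.Adj]
    {δ τmax : Fin N → ℝ} {ω : ℝ} (hω : 0 < ω) {i : Fin N} (hδ : 0 < δ i) {τ : ℝ} (hτ : 0 ≤ τ)
    (h : τ < tauTilde G δ τmax ω i) :
    τ * ((G.degree i : ℝ) ^ 2 +
        ∑ j ∈ G.neighborFinset i, (G.degree j : ℝ) * Real.exp (ω * τmax j)) ≤
      δ i * Real.exp (-ω * τ) := by
  rw [tauTilde] at h
  set C : ℝ := (G.degree i : ℝ) ^ 2 +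
    ∑ j ∈ G.neighborFinset i, (G.degree j : ℝ) * Real.exp (ω * τmax j) with hC
  have hC0 : 0 ≤ C := by positivity
  set S := {τ : ℝ | 0 < τ ∧ τ * C = δ i * Real.exp (-ω * τ)} with hS
  -- Since `sInf ∅ = 0`, the hypothesis `0 ≤ τ < sInf S` already forces a root to exist.
  have hne : S.Nonempty := by
    by_contra hne
    rw [Set.not_nonempty_iff_eq_empty] at hne
    rw [hne, Real.sInf_empty] at h
    linarith
  obtain ⟨τ₀, hτ₀⟩ := hne
  have hlt : τ < τ₀ := h.trans_le (csInf_le ⟨0, fun y hy => hy.1.le⟩ hτ₀)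
  calc τ * C ≤ τ₀ * C := mul_le_mul_of_nonneg_right hlt.le hC0
    _ = δ i * Real.exp (-ω * τ₀) := hτ₀.2
    _ ≤ δ i * Real.exp (-ω * τ) := by
        refine mul_le_mul_of_nonneg_left (Real.exp_le_exp.mpr ?_) hδ.le
        nlinarith

namespace IsRun

variable {N : ℕ} {G : SimpleGraph (Fin N)} [DecidableRel G.Adj] {E : ℝ → ℝ} {R : ℕ}
  {δ τmin τmax x₀ : Fin N → ℝ} {x u : ℝ → Fin N → ℝ} {T : Fin N → ℕ → ℝ}

theorem le_triggerDelay (i : Fin N) (s : ℝ) :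
    (τmin i : EReal) ≤ triggerDelay G E δ τmin u i s := by
  refine le_sInf ?_
  rintro _ ⟨τ, hτ, rfl⟩
  exact EReal.coe_le_coe_iff.mpr hτ.1

variable (hrun : IsRun G E R δ τmin τmax x₀ x u T)
include hrun

theorem add_le_next {i : Fin N} (h : τmin i ≤ τmax i) (k : ℕ) : T i k + τmin i ≤ T i (k + 1) := by
  have h1 : ((T i k + τmin i : ℝ) : EReal) ≤ (T i (k + 1) : ℝ) := by
    rw [hrun.step i k, EReal.coe_add]
    gcongr
    exact le_min (le_triggerDelay i _) (EReal.coe_le_coe_iff.mpr h)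
  exact_mod_cast h1

theorem next_le_add (i : Fin N) (k : ℕ) : T i (k + 1) ≤ T i k + τmax i := by
  have h1 : ((T i (k + 1) : ℝ) : EReal) ≤ (T i k + τmax i : ℝ) := by
    rw [hrun.step i k, EReal.coe_add]
    gcongr
    exact min_le_right _ _
  exact_mod_cast h1

theorem abs_samplingError_lt {i : Fin N} {k : ℕ} {τ : ℝ} (h1 : τmin i ≤ τ)
    (h2 : T i k + τ < T i (k + 1)) : |samplingError G u i (T i k) τ| < δ i * E (T i k + τ) := by
  by_contra hcon
  rw [not_lt] at hcon
  have h3 : triggerDelay G E δ τmin u i (T i k) ≤ (τ : EReal) := sInf_le ⟨τ, ⟨h1, hcon⟩, rfl⟩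
  have h4 : ((T i (k + 1) : ℝ) : EReal) ≤ (T i k + τ : ℝ) := by
    rw [hrun.step i k, EReal.coe_add]
    gcongr
    exact (min_le_left _ _).trans h3
  exact absurd (EReal.coe_le_coe_iff.mp h4) (not_le.mpr h2)

theorem nat_mul_le {i : Fin N} (h : τmin i ≤ τmax i) (k : ℕ) : k * τmin i ≤ T i k := by
  induction k with
  | zero => simp [hrun.start]
  | succ k ih =>
    have := hrun.add_le_next h k
    push_cast
    linarith

theorem finite_lt {i : Fin N} (h0 : 0 < τmin i) (h : τmin i ≤ τmax i) (t : ℝ) :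
    {k | T i k < t}.Finite := by
  obtain ⟨n, hn⟩ := exists_nat_gt (t / τmin i)
  refine (Set.finite_lt_nat n).subset fun k (hk : T i k < t) => ?_
  have h1 := hrun.nat_mul_le h k
  have h2 : (k : ℝ) < t / τmin i := by
    rw [lt_div_iff₀ h0]; linarith
  exact_mod_cast h2.trans hn

theorem exists_sampling_interval {i : Fin N} (h0 : 0 < τmin i) (h : τmin i ≤ τmax i) {s : ℝ}
    (hs : 0 ≤ s) : ∃ k, T i k ≤ s ∧ s < T i (k + 1) := by
  have hex : ∃ k, s < T i k := by
    obtain ⟨n, hn⟩ := exists_nat_gt (s / τmin i)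
    refine ⟨n, ?_⟩
    rw [div_lt_iff₀ h0] at hn
    exact hn.trans_le (hrun.nat_mul_le h n)
  classical
  rcases hk : Nat.find hex with _ | k
  · have := Nat.find_spec hex
    rw [hk, hrun.start] at this
    linarith
  · refine ⟨k, not_lt.mp (Nat.find_min hex (by omega)), ?_⟩
    have := Nat.find_spec hex
    rwa [hk] at this

theorem intervalIntegrable (i : Fin N) {a b : ℝ} (ha : 0 ≤ a) (hb : 0 ≤ b) :
    IntervalIntegrable (fun s => u s i) MeasureTheory.volume a b :=
  (hrun.integrable i a ha).symm.trans (hrun.integrable i b hb)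

theorem integral_eq_sub (i : Fin N) {a b : ℝ} (ha : 0 ≤ a) (hb : 0 ≤ b) :
    ∫ s in a..b, u s i = x b i - x a i := by
  rw [hrun.dynamics i a ha, hrun.dynamics i b hb,
    ← intervalIntegral.integral_add_adjacent_intervals (hrun.integrable i a ha)
      (hrun.intervalIntegrable i ha hb)]
  ring

/-- The trigger sees only inputs, but their integrals are state increments, so it monitors the
change of `(L x)_i` since the sampling. -/
theorem samplingError_eq (i : Fin N) {a τ : ℝ} (ha : 0 ≤ a) (hτ : 0 ≤ τ) :
    samplingError G u i a τ = ∑ j ∈ G.neighborFinset i, (x (a + τ) i - x (a + τ) j) -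
      ∑ j ∈ G.neighborFinset i, (x a i - x a j) := by
  have hb : 0 ≤ a + τ := by positivity
  rw [samplingError, ← Finset.sum_sub_distrib]
  refine Finset.sum_congr rfl fun j _ => ?_
  rw [intervalIntegral.integral_sub (hrun.intervalIntegrable i ha hb)
    (hrun.intervalIntegrable j ha hb), hrun.integral_eq_sub i ha hb, hrun.integral_eq_sub j ha hb]
  ring

theorem continuousOn (i : Fin N) (t : ℝ) : ContinuousOn (fun s => x s i) (Set.Icc 0 t) := by
  rcases lt_or_ge t 0 with ht | ht
  · simp [Set.Icc_eq_empty (not_le.mpr ht)]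
  have h := intervalIntegral.continuousOn_primitive_interval' (hrun.integrable i t ht)
    Set.left_mem_uIcc
  rw [Set.uIcc_of_le ht] at h
  exact (continuousOn_const (c := x₀ i) |>.add h).congr fun s hs => hrun.dynamics i s hs.1

/-- Wherever the latest sampling was unsaturated, the state has a right derivative. -/
theorem hasDerivWithinAt {i : Fin N} {k : ℕ} {s : ℝ} (h0 : 0 ≤ T i k) (h1 : T i k ≤ s)
    (h2 : s < T i (k + 1)) (h : Unsaturated G E x i (T i k)) :
    HasDerivWithinAt (fun r => x r i) (u s i) (Set.Ici s) s := by
  have hs0 : 0 ≤ s := h0.trans h1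
  have hlin : HasDerivWithinAt (fun r => x s i + (r - s) * u s i) (u s i) (Set.Ici s) s := by
    simpa using (((hasDerivAt_id s).sub_const s).mul_const (u s i)).const_add (x s i)
      |>.hasDerivWithinAt
  refine hlin.congr_of_eventuallyEq ?_ (by simp)
  have hmem : Set.Ico s (T i (k + 1)) ∈ nhdsWithin s (Set.Ici s) := Ico_mem_nhdsGE h2
  filter_upwards [hmem] with r hr
  -- The input is held constant until the next sampling, so `x_i` is affine there.
  have heq : ∫ p in s..r, u p i = ∫ _ in s..r, u s i := by
    refine intervalIntegral.integral_congr fun p hp => ?_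
    rw [Set.uIcc_of_le hr.1] at hp
    rw [hrun.input i k h p (h1.trans hp.1) (hp.2.trans_lt hr.2), hrun.input i k h s h1 h2]
  rw [intervalIntegral.integral_const, hrun.integral_eq_sub i hs0 (hs0.trans hr.1),
    smul_eq_mul] at heq
  linarith

end IsRun

/-! ### Input errors and convergence -/

namespace IsRun

variable {N : ℕ} {G : SimpleGraph (Fin N)} [DecidableRel G.Adj] {E : ℝ → ℝ} {R₀ : ℕ}
  {δ τmin τmax x₀ : Fin N → ℝ} {x u : ℝ → Fin N → ℝ} {T : Fin N → ℕ → ℝ} {A ω : ℝ}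

/-- If all samplings up to time `s` are unsaturated, then `|u_j(r)| ≤ d_j e^{ω τ_max^j} E(r)` for
`0 ≤ r ≤ s`. -/
theorem abs_input_le (hrun : IsRun G E (2 * R₀ + 1) δ τmin τmax x₀ x u T) (hA : 0 < A)
    (hω : 0 < ω) (hE : ∀ t, E t = A * Real.exp (-ω * t)) (hτ0 : ∀ i, 0 < τmin i)
    (hτ : ∀ i, τmin i ≤ τmax i) {s : ℝ}
    (hs : ∀ i k, T i k ≤ s → Unsaturated G E x i (T i k)) (j : Fin N) {r : ℝ} (hr0 : 0 ≤ r)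
    (hrs : r ≤ s) : |u r j| ≤ G.degree j * Real.exp (ω * τmax j) * E r := by
  obtain ⟨l, hl1, hl2⟩ := hrun.exists_sampling_interval (hτ0 j) (hτ j) hr0
  have hunsat := hs j l (hl1.trans hrs)
  have hEpos : 0 < E (T j l) := by rw [hE]; positivity
  rw [hrun.input j l hunsat r hl1 hl2, abs_neg, mul_assoc]
  refine (abs_quantizedSum_le hEpos hunsat).trans ?_
  refine mul_le_mul_of_nonneg_left ?_ (by positivity)
  -- The latest sampling of `j` is at most `τmax j` old, which costs the factor `e^{ω τmax j}` in
  -- `E`.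
  have h1 := hrun.next_le_add j l
  rw [hE, hE, mul_left_comm, ← Real.exp_add]
  refine mul_le_mul_of_nonneg_left (Real.exp_le_exp.mpr ?_) hA.le
  nlinarith

/-- Before the minimal inter-sampling time has elapsed, the sampling error stays below the
threshold as well. -/
theorem abs_samplingError_le_of_lt_tauMin
    (hrun : IsRun G E (2 * R₀ + 1) δ τmin τmax x₀ x u T) (hA : 0 < A)
    (hω : 0 < ω) (hE : ∀ t, E t = A * Real.exp (-ω * t)) (hδ : ∀ i, 0 < δ i)
    (hτ0 : ∀ i, 0 < τmin i) (hτ : ∀ i, τmin i ≤ min (tauTilde G δ τmax ω i) (τmax i)) {s : ℝ}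
    (hs : ∀ i k, T i k ≤ s → Unsaturated G E x i (T i k)) {i : Fin N} {k : ℕ}
    (h0 : 0 ≤ T i k) (h1 : T i k ≤ s) (h2 : s < T i (k + 1)) (h3 : s - T i k < τmin i) :
    |samplingError G u i (T i k) (s - T i k)| ≤ δ i * E s := by
  have hτ' : ∀ i, τmin i ≤ τmax i := fun i => (hτ i).trans (min_le_right _ _)
  set a := T i k with ha
  set τ := s - a with hτdef
  have hτ_nonneg : 0 ≤ τ := sub_nonneg.mpr h1
  have hEa : 0 < E a := by rw [hE]; positivity
  -- Agent `i` holds the input sampled at `a`, hence no exponential factor; a neighbour's sample may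
  -- be older. Summing over `j` turns `d_i` into `d_i ^ 2`, the coefficient in the equation for
  -- `tauTilde`.
  have hbound : ∀ j ∈ G.neighborFinset i, |∫ r in a..(a + τ), (u r i - u r j)| ≤
      (G.degree i + G.degree j * Real.exp (ω * τmax j)) * E a * τ := by
    intro j _
    have hC : ∀ r ∈ Set.uIoc a (a + τ), ‖u r i - u r j‖ ≤
        (G.degree i + G.degree j * Real.exp (ω * τmax j)) * E a := by
      intro r hr
      rw [Set.uIoc_of_le (by linarith)] at hr
      have hrs : r ≤ s := by have := hr.2; linarith
      have hi : |u r i| ≤ G.degree i * E a := by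
        rw [hrun.input i k (hs i k h1) r hr.1.le (hrs.trans_lt h2), abs_neg]
        exact abs_quantizedSum_le hEa (hs i k h1)
      have hj := hrun.abs_input_le hA hω hE hτ0 hτ' hs j (h0.trans hr.1.le) hrs
      have hEr : E r ≤ E a := by
        rw [hE, hE]
        refine mul_le_mul_of_nonneg_left (Real.exp_le_exp.mpr ?_) hA.le
        nlinarith [hr.1]
      have hj' : |u r j| ≤ G.degree j * Real.exp (ω * τmax j) * E a :=
        hj.trans (mul_le_mul_of_nonneg_left hEr (by positivity))
      rw [Real.norm_eq_abs]
      refine (abs_sub _ _).trans ?_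
      linarith
    have := intervalIntegral.norm_integral_le_of_norm_le_const hC
    rwa [Real.norm_eq_abs, add_sub_cancel_left, abs_of_nonneg hτ_nonneg] at this
  refine (Finset.abs_sum_le_sum_abs _ _).trans ((Finset.sum_le_sum hbound).trans ?_)
  rw [← Finset.sum_mul, ← Finset.sum_mul, Finset.sum_add_distrib, Finset.sum_const,
    G.card_neighborFinset_eq_degree, nsmul_eq_mul, ← sq]
  have hmain := mul_le_of_lt_tauTilde G hω (hδ i) hτ_nonneg
    (h3.trans_le ((hτ i).trans (min_le_left _ _)))
  have hEs : E s = Real.exp (-ω * τ) * E a := by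
    rw [hE, hE, mul_left_comm, ← Real.exp_add, hτdef]
    congr 2
    ring
  calc _ = τ * ((G.degree i : ℝ) ^ 2 + ∑ j ∈ G.neighborFinset i,
          (G.degree j : ℝ) * Real.exp (ω * τmax j)) * E a := by ring
    _ ≤ δ i * Real.exp (-ω * τ) * E a := mul_le_mul_of_nonneg_right hmain hEa.le
    _ = δ i * E s := by rw [hEs]; ring

/-- If all samplings up to time `s` are unsaturated, then the input differs from the ideal input
`-L x(s)` by at most `κ(ω) E(s)`. -/
theorem norm_input_add_lapMatrix_mulVec_le
    (hrun : IsRun G E (2 * R₀ + 1) δ τmin τmax x₀ x u T) (hA : 0 < A)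
    (hω : 0 < ω) (hE : ∀ t, E t = A * Real.exp (-ω * t)) (hδ : ∀ i, 0 < δ i)
    (hτ0 : ∀ i, 0 < τmin i) (hτ : ∀ i, τmin i ≤ min (tauTilde G δ τmax ω i) (τmax i)) {s : ℝ}
    (hs0 : 0 ≤ s) (hs : ∀ i k, T i k ≤ s → Unsaturated G E x i (T i k)) :
    ‖u s + (G.lapMatrix ℝ).mulVec (x s)‖ ≤ kappa G (2 * R₀ + 1) δ τmax ω * E s := by
  have hτ' : ∀ i, τmin i ≤ τmax i := fun i => (hτ i).trans (min_le_right _ _)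
  have hEs : 0 < E s := by rw [hE]; positivity
  have hκ : 0 ≤ kappa G (2 * R₀ + 1) δ τmax ω :=
    Real.iSup_nonneg fun i => by have := (hδ i).le; positivity
  refine (pi_norm_le_iff_of_nonneg (by positivity)).mpr fun i => ?_
  obtain ⟨k, h1, h2⟩ := hrun.exists_sampling_interval (hτ0 i) (hτ' i) hs0
  have h0 : 0 ≤ T i k := by
    have := (hτ0 i).le
    exact le_trans (by positivity) (hrun.nat_mul_le (hτ' i) k)
  have hunsat := hs i k h1
  have hEa : 0 < E (T i k) := by rw [hE]; positivity
  have hsamp : |samplingError G u i (T i k) (s - T i k)| ≤ δ i * E s := by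
    -- The trigger tests only delays of at least `τmin i`; shorter ones need the a priori input
    -- bounds.
    rcases lt_or_ge (s - T i k) (τmin i) with h3 | h3
    · exact hrun.abs_samplingError_le_of_lt_tauMin hA hω hE hδ hτ0 hτ hs h0 h1 h2 h3
    · have := hrun.abs_samplingError_lt h3 (by rwa [add_sub_cancel])
      rw [add_sub_cancel] at this
      exact this.le
  have hquant := abs_sum_sub_quantizedSum_le (R₀ := R₀) hEa hunsat
  have hEle : E (T i k) ≤ Real.exp (ω * τmax i) * E s := by
    have := hrun.next_le_add i k
    rw [hE, hE, mul_left_comm, ← Real.exp_add]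
    refine mul_le_mul_of_nonneg_left (Real.exp_le_exp.mpr ?_) hA.le
    nlinarith
  have heq := hrun.samplingError_eq i h0 (sub_nonneg.mpr h1)
  rw [add_sub_cancel] at heq
  rw [Pi.add_apply, Real.norm_eq_abs, lapMatrix_mulVec_eq_sum_sub,
    hrun.input i k hunsat s h1 h2]
  have hkap : δ i + (G.degree i : ℝ) * Real.exp (ω * τmax i) / ((2 * R₀ + 1 : ℕ) : ℝ) ≤
      kappa G (2 * R₀ + 1) δ τmax ω :=
    le_ciSup (f := fun i => δ i + (G.degree i : ℝ) * Real.exp (ω * τmax i) /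
      ((2 * R₀ + 1 : ℕ) : ℝ)) (Set.finite_range _).bddAbove i
  calc _ = |samplingError G u i (T i k) (s - T i k) +
        (∑ j ∈ G.neighborFinset i, (x (T i k) i - x (T i k) j) -
          quantizedSum G E (2 * R₀ + 1) x i (T i k))| := by
        rw [heq]; congr 1; ring
    _ ≤ δ i * E s + G.degree i * (E (T i k) / (2 * R₀ + 1 : ℕ)) :=
        (abs_add_le _ _).trans (add_le_add hsamp hquant)
    _ ≤ δ i * E s + G.degree i * (Real.exp (ω * τmax i) * E s / (2 * R₀ + 1 : ℕ)) := by
        gcongr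
    _ = (δ i + (G.degree i : ℝ) * Real.exp (ω * τmax i) / ((2 * R₀ + 1 : ℕ) : ℝ)) * E s := by
        ring
    _ ≤ _ := mul_le_mul_of_nonneg_right hkap hEs.le

end IsRun

/-! ### Decay of the perturbed Laplacian flow. -/

section Convergence

variable {N : ℕ} {G : SimpleGraph (Fin N)} [DecidableRel G.Adj]

open Matrix in
/-- A trajectory of `x' = -L x + w` (right derivatives) with `‖w(s)‖ ≤ κ E(s)` satisfies
`|||x(t)||| ≤ E(t) / 2`. -/
theorem consensusSeminorm_le_of_hasDerivWithinAt (hN : 2 ≤ N) (hG : G.Connected) {γ : ℝ}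
    (hγ : 0 < γ) (hγ_le : γ ≤ algebraicConnectivity hN G) {E₀ ω κ : ℝ} (hE₀ : 0 < E₀)
    (hω_le : ω ≤ γ - 2 * GammaInf G γ * κ) {x u : ℝ → Fin N → ℝ}
    (hx₀ : ‖x 0 - fun _ => ave (x 0)‖ ≤ E₀) {t : ℝ} (ht : 0 ≤ t)
    (hcont : ContinuousOn x (Set.Icc 0 t))
    (hderiv : ∀ s ∈ Set.Ico 0 t, HasDerivWithinAt x (u s) (Set.Ici s) s)
    (hu : ∀ s ∈ Set.Ico 0 t,
      ‖u s + (G.lapMatrix ℝ) *ᵥ (x s)‖ ≤ κ * quantRange G γ E₀ ω s) :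
    consensusSeminorm G γ (x t) ≤ quantRange G γ E₀ ω t / 2 := by
  have hΓ := GammaInf_pos G hN hG hγ hγ_le
  set Γ := GammaInf G γ with hΓdef
  refine ciSup_le fun ⟨r, hr⟩ => ?_
  rw [Set.mem_Ici] at hr
  rw [expNegLap_mulVec_sub_ave, norm_smul, Real.norm_eq_abs, Real.abs_exp]
  change Real.exp (γ * r) * _ ≤ _
  -- The supremum over `r` is absorbed by aiming the kernel at time `t + r` while stopping the
  -- trajectory at `s = t`.
  have hfcont : ContinuousOn
      (fun s => (expNegLap G (t + r - s) - averagingMatrix N) *ᵥ x s) (Set.Icc 0 t) := by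
    refine continuousOn_pi.mpr fun i => ?_
    change ContinuousOn (fun s => ∑ j, (expNegLap G (t + r - s) i j - averagingMatrix N i j) *
      x s j) _
    refine continuousOn_finsetSum Finset.univ fun j _ => ?_
    refine ContinuousOn.mul ?_ (continuousOn_pi.mp hcont j)
    exact (fun s _ => (((hasDerivAt_expNegLap_apply G (t + r - s) i j).comp_const_sub
      (t + r) s).sub_const _).continuousAt.continuousWithinAt)
  -- This majorant starts at the bound for `P(t + r) x(0)` and has growth rate `γ - ω`; at `s = t`,
  -- multiplied by `e^{γr}`, it equals `Γ E₀ e^{-ωt}`.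
  have hB : ∀ s, HasDerivAt
      (fun s => Γ * E₀ * Real.exp (-γ * (t + r)) * Real.exp ((γ - ω) * s))
      (Γ * E₀ * Real.exp (-γ * (t + r)) * (Real.exp ((γ - ω) * s) * ((γ - ω) * 1))) s :=
    fun s => (((hasDerivAt_id s).const_mul (γ - ω)).exp).const_mul _
  have hH : ∀ s, 0 ≤ s → ∀ v : Fin N → ℝ, ‖(expNegLap G s - averagingMatrix N) *ᵥ v‖ ≤
      Real.exp (-γ * s) * (Γ * ‖v‖) := fun s hs v => by
    have := exp_mul_norm_mulVec_le G hN hG hγ hγ_le hs v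
    rw [neg_mul, Real.exp_neg, ← div_eq_inv_mul, le_div_iff₀' (Real.exp_pos _)]
    exact this
  have key := image_norm_le_of_norm_deriv_right_le_deriv_boundary hfcont
    (fun s hs => hasDerivWithinAt_expNegLap_sub_mulVec G (hderiv s hs) (t + r)) ?_ hB ?_
    (Set.right_mem_Icc.mpr ht)
  · rw [add_sub_cancel_left] at key
    calc _ ≤ Real.exp (γ * r) *
          (Γ * E₀ * Real.exp (-γ * (t + r)) * Real.exp ((γ - ω) * t)) :=
          mul_le_mul_of_nonneg_left key (Real.exp_pos _).le
      _ = Γ * E₀ * (Real.exp (γ * r) * Real.exp (-γ * (t + r)) * Real.exp ((γ - ω) * t)) := by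
          ring
      _ = quantRange G γ E₀ ω t / 2 := by
          rw [← Real.exp_add, ← Real.exp_add, quantRange,
            show γ * r + -γ * (t + r) + (γ - ω) * t = -ω * t by ring]
          ring
  · have h0 : (expNegLap G (t + r - 0) - averagingMatrix N) *ᵥ x 0 =
        (expNegLap G (t + r) - averagingMatrix N) *ᵥ (x 0 - fun _ => ave (x 0)) := by
      rw [sub_zero, Matrix.mulVec_sub, Matrix.sub_mulVec _ _ (fun _ => ave (x 0)),
        expNegLap_mulVec_const, averagingMatrix_mulVec_const hN, sub_self, sub_zero]
    rw [h0, mul_zero, Real.exp_zero, mul_one]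
    refine (hH _ (by positivity) _).trans ?_
    calc _ ≤ Real.exp (-γ * (t + r)) * (Γ * E₀) := by gcongr
      _ = _ := by ring
  · intro s hs
    refine (hH _ (by linarith [hs.2]) _).trans ?_
    have hE : quantRange G γ E₀ ω s = 2 * Γ * E₀ * Real.exp (-ω * s) := rfl
    have hexp : Real.exp (-γ * (t + r - s)) * Real.exp (-ω * s) =
        Real.exp (-γ * (t + r)) * Real.exp ((γ - ω) * s) := by
      rw [← Real.exp_add, ← Real.exp_add]
      congr 1
      ring
    calc _ ≤ Real.exp (-γ * (t + r - s)) * (Γ * (κ * (2 * Γ * E₀ * Real.exp (-ω * s)))) := by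
          rw [← hE]
          gcongr
          exact hu s hs
      _ = Γ * E₀ * (Real.exp (-γ * (t + r - s)) * Real.exp (-ω * s)) * (2 * Γ * κ) := by ring
      _ = Γ * E₀ * (Real.exp (-γ * (t + r)) * Real.exp ((γ - ω) * s)) * (2 * Γ * κ) := by
          rw [hexp]
      _ ≤ Γ * E₀ * (Real.exp (-γ * (t + r)) * Real.exp ((γ - ω) * s)) * (γ - ω) := by
          refine mul_le_mul_of_nonneg_left (by linarith) (by positivity)
      _ = _ := by ring

/-- `|||v||| ≤ E / 2` bounds all differences of entries of `v` by `E`. -/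
theorem abs_sub_le_of_consensusSeminorm_le (hN : 2 ≤ N) (hG : G.Connected) {γ : ℝ}
    (hγ : 0 < γ) (hγ_le : γ ≤ algebraicConnectivity hN G) {v : Fin N → ℝ} {E : ℝ}
    (h : consensusSeminorm G γ v ≤ E / 2) (i j : Fin N) : |v i - v j| ≤ E := by
  have hbdd : BddAbove (Set.range fun t : Set.Ici (0 : ℝ) =>
      ‖Real.exp (γ * (t : ℝ)) • (expNegLap G (t : ℝ)).mulVec (v - fun _ => ave v)‖) := by
    refine ⟨GammaInf G γ * ‖v‖, ?_⟩
    rintro _ ⟨⟨t, ht⟩, rfl⟩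
    simp only [expNegLap_mulVec_sub_ave, norm_smul, Real.norm_eq_abs, Real.abs_exp]
    exact exp_mul_norm_mulVec_le G hN hG hγ hγ_le ht v
  -- The term at time `0` is the distance of `v` from its average.
  have h0 := (le_ciSup hbdd (⟨0, Set.self_mem_Ici⟩ : Set.Ici (0 : ℝ))).trans h
  simp only [mul_zero, Real.exp_zero, one_smul, expNegLap_zero, Matrix.one_mulVec] at h0
  have hi := (norm_le_pi_norm (v - fun _ => ave v) i).trans h0
  have hj := (norm_le_pi_norm (v - fun _ => ave v) j).trans h0
  rw [Pi.sub_apply, Real.norm_eq_abs] at hi hj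
  calc |v i - v j| = |(v i - ave v) - (v j - ave v)| := by congr 1; ring
    _ ≤ |v i - ave v| + |v j - ave v| := abs_sub _ _
    _ ≤ E := by linarith

end Convergence

end QuantizedConsensus

/-! ### Induction over the sampling times. -/

open QuantizedConsensus in
theorem mainTheorem7 {N : ℕ} (hN : 2 ≤ N)
    (G : SimpleGraph (Fin N)) [DecidableRel G.Adj] (hG : G.Connected)
    (γ : ℝ) (hγ_pos : 0 < γ) (hγ_le : γ ≤ QuantizedConsensus.algebraicConnectivity hN G)
    (R R₀ : ℕ) (hR : R = 2 * R₀ + 1)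
    (δ τmin τmax : Fin N → ℝ) (hδ : ∀ i, 0 < δ i) (hτmax : ∀ i, 0 < τmax i)
    (x₀ : Fin N → ℝ) (E₀ : ℝ) (hE₀ : 0 < E₀)
    (hx₀ : ∀ i, |x₀ i - (1 / (N : ℝ)) * ∑ j, x₀ j| ≤ E₀)
    (ω : ℝ) (hω_pos : 0 < ω)
    (hω_le : ω ≤ γ - 2 * QuantizedConsensus.GammaInf G γ *
      QuantizedConsensus.kappa G R δ τmax ω)
    (hτmin_pos : ∀ i, 0 < τmin i)
    (hτmin_le : ∀ i, τmin i ≤ min (QuantizedConsensus.tauTilde G δ τmax ω i) (τmax i))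
    (x u : ℝ → Fin N → ℝ) (T : Fin N → ℕ → ℝ)
    (hrun : QuantizedConsensus.IsRun G (QuantizedConsensus.quantRange G γ E₀ ω) R
      δ τmin τmax x₀ x u T) :
    ∀ t : ℝ, 0 ≤ t → QuantizedConsensus.consensusSeminorm G γ (x t) ≤
      QuantizedConsensus.quantRange G γ E₀ ω t / 2 := by
  subst hR
  have hΓ := GammaInf_pos G hN hG hγ_pos hγ_le
  have hA : 0 < 2 * GammaInf G γ * E₀ := by positivity
  have hτ : ∀ i, τmin i ≤ τmax i := fun i => (hτmin_le i).trans (min_le_right _ _)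
  have hT0 : ∀ i k, 0 ≤ T i k := fun i k =>
    le_trans (mul_nonneg (Nat.cast_nonneg k) (hτmin_pos i).le) (hrun.nat_mul_le (hτ i) k)
  have hx0 : x 0 = x₀ := by
    ext i
    simp [hrun.dynamics i 0 le_rfl]
  have hfin : ∀ t, {p : Fin N × ℕ | T p.1 p.2 < t}.Finite := fun t => by
    refine (Set.finite_iUnion fun i =>
      (hrun.finite_lt (hτmin_pos i) (hτ i) t).image (Prod.mk i)).subset ?_
    rintro ⟨i, k⟩ hk
    exact Set.mem_iUnion.mpr ⟨i, k, hk, rfl⟩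
  intro t
  -- Pairs `(agent, index)` are counted, so simultaneous samplings of different agents count
  -- separately.
  induction hn : {p : Fin N × ℕ | T p.1 p.2 < t}.ncard using Nat.strong_induction_on
    generalizing t with
  | _ n ih =>
  intro ht
  have hunsat : ∀ i k, T i k < t →
      Unsaturated G (quantRange G γ E₀ ω) x i (T i k) := by
    intro i k hk j _
    refine abs_sub_le_of_consensusSeminorm_le hN hG hγ_pos hγ_le
      (ih _ ?_ (T i k) rfl (hT0 i k)) i j
    rw [← hn]
    -- The pair `(i, k)` is counted before `t` but not before `T i k` itself, so the count drops
    -- strictly.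
    refine Set.ncard_lt_ncard ⟨fun p (hp : T p.1 p.2 < T i k) => hp.trans hk, fun hsub => ?_⟩
      (hfin t)
    exact lt_irrefl (T i k) (hsub (show (i, k) ∈ {p : Fin N × ℕ | T p.1 p.2 < t} from hk))
  refine consensusSeminorm_le_of_hasDerivWithinAt (u := u) hN hG hγ_pos hγ_le hE₀ hω_le ?_
    ht
    (continuousOn_pi.mpr fun i => hrun.continuousOn i t) ?_ ?_
  · rw [hx0]
    exact (pi_norm_le_iff_of_nonneg hE₀.le).mpr hx₀
  · intro s hs
    refine hasDerivWithinAt_pi.mpr fun i => ?_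
    obtain ⟨k, h1, h2⟩ := hrun.exists_sampling_interval (hτmin_pos i) (hτ i) hs.1
    exact hrun.hasDerivWithinAt (hT0 i k) h1 h2 (hunsat i k (h1.trans_lt hs.2))
  -- Only `s < t` is needed, so samplings exactly at `t`, which the induction does not cover, play
  -- no role.
  · intro s hs
    exact hrun.norm_input_add_lapMatrix_mulVec_le hA hω_pos (fun _ => rfl) hδ hτmin_pos hτmin_le
      hs.1 fun i k hk => hunsat i k (hk.trans_lt hs.2)
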